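/- **Poincaré–Wirtinger inequality on hypersurfaces.** Let $N\ge 3$ and let $M\subset\mathbb{R}^N$ be a smooth, compact, connected (in particular non-empty) embedded hypersurface without boundary. Write $\mathcal H^{N-1}$ for the $(N-1)$-dimensional Hausdorff measure, let $L^1(M)=L^1(M,\mathcal H^{N-1})$, and let $W^{1,1}(M)$ be the space of real functions $u\in L^1(M)$ that have a weak tangential gradient $\nabla_M u\in L^1(M;\mathbb{R}^N)$; that is, $\nabla_M u$ is tangent to $M$ almost everywhere, and for every smooth local parametrization $\psi:V\to M$, $V\subset\mathbb{R}^{N-1}$ open, and every $v\in\mathbb{R}^{N-1}$, the weak derivative of $u\circ\psi$ on $V$ in the direction $v$ is $\langle(\nabla_M u)\circ\psi,\,D\psi\,v\rangle$. Then there exists a constant $C=C(N,M)>0$ such that for every $u\in W^{1,1}(M)$ $$\|u-u_M\|_{L^1(M)}\le C\,\|\nabla_M u\|_{L^1(M)},\qquad u_M:=\frac{1}{\mathcal H^{N-1}(M)}\int_M u\,d\mathcal H^{N-1}.$$ -/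

import Mathlib

open MeasureTheory Set
open scoped ContDiff

/-- A smooth local parametrization of the subset `M` of `ℝ^N` in `N - 1` variables: a smooth
immersion `ψ` on the open set `V ⊆ ℝ^(N-1)` that is a homeomorphism of `V` onto the relatively open
subset `M ∩ U` of `M`. -/
structure IsLocalParametrization {N : ℕ} (M : Set (EuclideanSpace ℝ (Fin N)))
    (V : Set (EuclideanSpace ℝ (Fin (N - 1)))) (U : Set (EuclideanSpace ℝ (Fin N)))
    (ψ : EuclideanSpace ℝ (Fin (N - 1)) → EuclideanSpace ℝ (Fin N)) : Prop where
  isOpen_domain : IsOpen V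
  isOpen_target : IsOpen U
  contDiffOn : ContDiffOn ℝ ∞ ψ V
  injective_fderiv : ∀ y ∈ V, Function.Injective (fderiv ℝ ψ y)
  image_eq : ψ '' V = M ∩ U
  exists_continuous_inverse : ∃ χ : EuclideanSpace ℝ (Fin N) → EuclideanSpace ℝ (Fin (N - 1)),
    ContinuousOn χ (M ∩ U) ∧ LeftInvOn χ ψ V

/-- `M ⊆ ℝ^N` is a smooth embedded hypersurface without boundary: every point of `M` lies in the
image of a smooth local parametrization of `M` by an open subset of `ℝ^(N-1)`. -/
def IsSmoothHypersurface {N : ℕ} (M : Set (EuclideanSpace ℝ (Fin N))) : Prop :=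
  ∀ p ∈ M, ∃ V U ψ, IsLocalParametrization M V U ψ ∧ p ∈ U

/-- `F` is the weak (distributional) derivative of `f` on the open set `V ⊆ ℝ^m`: both are locally
integrable on `V` and `∫ f ∂_v φ = - ∫ (F v) φ` for all test functions `φ` and directions `v`. -/
structure HasWeakFDerivOn {m : ℕ} (V : Set (EuclideanSpace ℝ (Fin m)))
    (f : EuclideanSpace ℝ (Fin m) → ℝ)
    (F : EuclideanSpace ℝ (Fin m) → (EuclideanSpace ℝ (Fin m) →L[ℝ] ℝ)) : Prop where
  locallyIntegrableOn : LocallyIntegrableOn f V volume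
  locallyIntegrableOn_deriv : LocallyIntegrableOn F V volume
  integral_eq : ∀ φ : EuclideanSpace ℝ (Fin m) → ℝ,
    ContDiff ℝ ∞ φ → HasCompactSupport φ → tsupport φ ⊆ V →
      ∀ v, ∫ y in V, f y * fderiv ℝ φ y v = - ∫ y in V, F y v * φ y

/-- `g` is the weak tangential gradient `∇_M u` of `u` on the hypersurface `M`. In every smooth
local parametrization `ψ`, the field `g` is almost everywhere tangent to `M` (it lies in the range
of `Dψ`), and the weak derivative of `u ∘ ψ` in the direction `v` is `⟨g ∘ ψ, Dψ v⟩`. Only the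
values of `u` and `g` on `M` matter. -/
structure HasWeakTangentialGradient {N : ℕ} (M : Set (EuclideanSpace ℝ (Fin N)))
    (u : EuclideanSpace ℝ (Fin N) → ℝ)
    (g : EuclideanSpace ℝ (Fin N) → EuclideanSpace ℝ (Fin N)) : Prop where
  tangent : ∀ V U ψ, IsLocalParametrization M V U ψ →
    ∀ᵐ y ∂(volume.restrict V), g (ψ y) ∈ Set.range (fderiv ℝ ψ y)
  weak_deriv : ∀ V U ψ, IsLocalParametrization M V U ψ →
    HasWeakFDerivOn V (fun y => u (ψ y))
      (fun y => (innerSL ℝ (g (ψ y))).comp (fderiv ℝ ψ y))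

/-- The surface measure on `M ⊆ ℝ^N`: the `(N-1)`-dimensional Hausdorff measure (normalized so as
to agree with Lebesgue measure on `ℝ^(N-1)`), restricted to `M`. -/
noncomputable def surfaceMeasure {N : ℕ} (M : Set (EuclideanSpace ℝ (Fin N))) :
    Measure (EuclideanSpace ℝ (Fin N)) :=
  (Measure.euclideanHausdorffMeasure (N - 1)).restrict M

/-- `u ∈ W^{1,1}(M)` with weak tangential gradient `∇_M u = g`: both `u` and `g` are in `L¹(M)`. -/
structure MemW11 {N : ℕ} (M : Set (EuclideanSpace ℝ (Fin N)))
    (u : EuclideanSpace ℝ (Fin N) → ℝ)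
    (g : EuclideanSpace ℝ (Fin N) → EuclideanSpace ℝ (Fin N)) : Prop where
  memLp : MemLp u 1 (surfaceMeasure M)
  memLp_gradient : MemLp g 1 (surfaceMeasure M)
  hasWeakTangentialGradient : HasWeakTangentialGradient M u g

/-!
The total oscillation `∬ |u x - u y| dμ(x) dμ(y)` controls the mean deviation of `u`, and unlike the
latter it is monotone in `μ` and does not involve a mean value. On a convex set in `ℝ^(N-1)` it is
bounded by the `L¹` norm of the derivative, by integrating along segments and mollifying; the
segment from `x` to `y` is cut at its midpoint, so that the change of variables always contracts by
a factor at least `1/2` and no singular kernel appears. A local parametrization is bi-Lipschitz near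
each point, which transports the bound to small pieces of `M`.

Two pieces `A` and `B` whose overlap has positive measure are glued by averaging
`|u x - u y| ≤ |u x - u z| + |u z - u y|` over `z ∈ A ∩ B`. Overlaps that meet `M` are relatively
open, hence of positive measure, and by connectedness and compactness finitely many such gluings
reach all of `M`.
-/

section TotalOscillation

open Filter
open scoped ENNReal Topology

variable {α β X : Type*} [MeasurableSpace α] [MeasurableSpace β] {μ ν ρ : Measure α}

/-- The total oscillation `∬ d(f x, f y) dμ(x) dμ(y)` of `f`. It is not divided by the mass of `μ`,
so that it is monotone in `μ`. -/
noncomputable def totalOscillation [PseudoEMetricSpace X] (μ : Measure α) (f : α → X) : ℝ≥0∞ :=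
  ∫⁻ y, ∫⁻ x, edist (f x) (f y) ∂μ ∂μ

theorem totalOscillation_mono_measure [PseudoEMetricSpace X] (h : μ ≤ ν) (f : α → X) :
    totalOscillation μ f ≤ totalOscillation ν f :=
  lintegral_mono' h fun _ => lintegral_mono' h fun _ => le_rfl

theorem totalOscillation_smul_measure [PseudoEMetricSpace X] {c : ℝ≥0∞} (hc : c ≠ ⊤)
    (μ : Measure α) (f : α → X) :
    totalOscillation (c • μ) f = c ^ 2 * totalOscillation μ f := by
  simp only [totalOscillation, lintegral_smul_measure, smul_eq_mul]
  rw [lintegral_const_mul' _ _ hc, ← mul_assoc, sq]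

theorem lintegral_enorm_sub_average_le {F : Type*} [NormedAddCommGroup F] [NormedSpace ℝ F]
    [CompleteSpace F] [IsFiniteMeasure μ] {f : α → F} (hf : Integrable f μ) :
    ∫⁻ x, ‖f x - ⨍ y, f y ∂μ‖ₑ ∂μ ≤ (μ univ)⁻¹ * totalOscillation μ f := by
  rcases eq_or_ne μ 0 with rfl | hμ
  · simp
  have : NeZero μ := ⟨hμ⟩
  have hdev (x : α) : f x - ⨍ y, f y ∂μ = ⨍ y, (f x - f y) ∂μ := by
    rw [average_eq', average_eq', integral_sub (integrable_const _) hf.to_average,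
      integral_const, probReal_univ, one_smul]
  rw [totalOscillation, ← lintegral_const_mul' _ _ (ENNReal.inv_ne_top.2 (NeZero.ne _))]
  refine lintegral_mono fun x => ?_
  calc ‖f x - ⨍ y, f y ∂μ‖ₑ ≤ ∫⁻ y, ‖f x - f y‖ₑ ∂((μ univ)⁻¹ • μ) := by
        rw [hdev]
        exact enorm_integral_le_lintegral_enorm _
    _ = (μ univ)⁻¹ * ∫⁻ y, edist (f y) (f x) ∂μ := by
        rw [lintegral_smul_measure, smul_eq_mul]
        simp only [edist_comm (f _) (f x), edist_eq_enorm_sub]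

variable [PseudoEMetricSpace X] [SecondCountableTopology X] [MeasurableSpace X]
  [OpensMeasurableSpace X]

theorem aemeasurable_lintegral_edist [SFinite ν] {f : α → X} (hμ : AEMeasurable f μ)
    (hν : AEMeasurable f ν) : AEMeasurable (fun y => ∫⁻ x, edist (f x) (f y) ∂ν) μ :=
  (hν.comp_snd.edist hμ.comp_fst).lintegral_prod_right'

theorem totalOscillation_map [SFinite μ] {ψ : α → β} (hψ : AEMeasurable ψ μ) {f : β → X}
    (hf : AEMeasurable f (μ.map ψ)) :
    totalOscillation (μ.map ψ) f = totalOscillation μ (f ∘ ψ) := by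
  rw [totalOscillation, lintegral_map' (aemeasurable_lintegral_edist hf hf) hψ]
  refine lintegral_congr fun y => ?_
  exact lintegral_map' (hf.edist aemeasurable_const) hψ

theorem totalOscillation_le_of_tendsto [SFinite μ] {f : α → X} {G : ℕ → α → X}
    (hG : ∀ n, AEMeasurable (G n) μ) (hlim : ∀ᵐ x ∂μ, Tendsto (fun n => G n x) atTop (𝓝 (f x)))
    {c : ℝ≥0∞} (hc : ∀ n, totalOscillation μ (G n) ≤ c) : totalOscillation μ f ≤ c := by
  calc ∫⁻ y, ∫⁻ x, edist (f x) (f y) ∂μ ∂μ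
      = ∫⁻ y, ∫⁻ x, liminf (fun n => edist (G n x) (G n y)) atTop ∂μ ∂μ := by
        refine lintegral_congr_ae (hlim.mono fun y hy => lintegral_congr_ae ?_)
        exact hlim.mono fun x hx => (hx.edist hy).liminf_eq.symm
    _ ≤ ∫⁻ y, liminf (fun n => ∫⁻ x, edist (G n x) (G n y) ∂μ) atTop ∂μ :=
        lintegral_mono fun y => lintegral_liminf_le' fun n => (hG n).edist aemeasurable_const
    _ ≤ liminf (fun n => totalOscillation μ (G n)) atTop :=
        lintegral_liminf_le' fun n => aemeasurable_lintegral_edist (hG n) (hG n)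
    _ ≤ c := liminf_le_of_le (h := fun b hb => (hb.exists.choose_spec).trans (hc _))

theorem mul_lintegral_lintegral_edist_le [IsFiniteMeasure μ] [IsFiniteMeasure ν] (hμ : ρ ≤ μ)
    (hν : ρ ≤ ν) {f : α → X} (hfμ : AEMeasurable f μ) (hfν : AEMeasurable f ν) :
    ρ univ * ∫⁻ y, ∫⁻ x, edist (f x) (f y) ∂ν ∂μ ≤
      μ univ * totalOscillation ν f + ν univ * totalOscillation μ f := by
  have : IsFiniteMeasure ρ := isFiniteMeasure_of_le μ hμ
  have htriangle (y x : α) : ρ univ * edist (f x) (f y) ≤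
      ∫⁻ z, edist (f z) (f x) ∂ν + ∫⁻ z, edist (f z) (f y) ∂μ :=
    calc ρ univ * edist (f x) (f y) = ∫⁻ _, edist (f x) (f y) ∂ρ := by
          rw [lintegral_const, mul_comm]
      _ ≤ ∫⁻ z, (edist (f z) (f x) + edist (f z) (f y)) ∂ρ :=
          lintegral_mono fun z => edist_triangle_left _ _ _
      _ = ∫⁻ z, edist (f z) (f x) ∂ρ + ∫⁻ z, edist (f z) (f y) ∂ρ :=
          lintegral_add_left' ((hfμ.mono_measure hμ).edist aemeasurable_const) _
      _ ≤ ∫⁻ z, edist (f z) (f x) ∂ν + ∫⁻ z, edist (f z) (f y) ∂μ := by gcongr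
  calc ρ univ * ∫⁻ y, ∫⁻ x, edist (f x) (f y) ∂ν ∂μ
      = ∫⁻ y, ∫⁻ x, ρ univ * edist (f x) (f y) ∂ν ∂μ := by
        simp only [lintegral_const_mul' _ _ (measure_ne_top ρ univ)]
    _ ≤ ∫⁻ y, ∫⁻ x, (∫⁻ z, edist (f z) (f x) ∂ν + ∫⁻ z, edist (f z) (f y) ∂μ) ∂ν ∂μ :=
        lintegral_mono fun y => lintegral_mono fun x => htriangle y x
    _ = ∫⁻ y, (totalOscillation ν f + ν univ * ∫⁻ z, edist (f z) (f y) ∂μ) ∂μ := by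
        refine lintegral_congr fun y => ?_
        rw [lintegral_add_left' (aemeasurable_lintegral_edist hfν hfν), lintegral_const,
          mul_comm (ν univ), totalOscillation]
    _ = μ univ * totalOscillation ν f + ν univ * totalOscillation μ f := by
        rw [lintegral_add_left measurable_const, lintegral_const,
          lintegral_const_mul' _ _ (measure_ne_top ν univ), mul_comm (μ univ), totalOscillation,
          totalOscillation]

theorem totalOscillation_add_measure_le [IsFiniteMeasure μ] [IsFiniteMeasure ν] (hμ : ρ ≤ μ)
    (hν : ρ ≤ ν) (hρ : ρ ≠ 0) {f : α → X} (hfμ : AEMeasurable f μ) (hfν : AEMeasurable f ν) :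
    totalOscillation (μ + ν) f ≤ totalOscillation μ f + totalOscillation ν f +
      2 * ((ρ univ)⁻¹ * (μ univ * totalOscillation ν f + ν univ * totalOscillation μ f)) := by
  have : IsFiniteMeasure ρ := isFiniteMeasure_of_le μ hμ
  have hρ₀ : ρ univ ≠ 0 := Measure.measure_univ_ne_zero.2 hρ
  have hcross₁ := mul_lintegral_lintegral_edist_le hμ hν hfμ hfν
  have hcross₂ := mul_lintegral_lintegral_edist_le hν hμ hfν hfμ
  rw [ENNReal.mul_le_iff_le_inv hρ₀ (measure_ne_top ρ univ)] at hcross₁ hcross₂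
  rw [add_comm (ν univ * _)] at hcross₂
  calc totalOscillation (μ + ν) f
      = (totalOscillation μ f + ∫⁻ y, ∫⁻ x, edist (f x) (f y) ∂ν ∂μ) +
          (∫⁻ y, ∫⁻ x, edist (f x) (f y) ∂μ ∂ν + totalOscillation ν f) := by
        simp only [totalOscillation, lintegral_add_measure]
        rw [lintegral_add_left' (aemeasurable_lintegral_edist hfμ hfμ),
          lintegral_add_left' (aemeasurable_lintegral_edist hfν hfμ)]
    _ ≤ (totalOscillation μ f +
          (ρ univ)⁻¹ * (μ univ * totalOscillation ν f + ν univ * totalOscillation μ f)) +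
        ((ρ univ)⁻¹ * (μ univ * totalOscillation ν f + ν univ * totalOscillation μ f) +
          totalOscillation ν f) := by gcongr
    _ = _ := by ring

end TotalOscillation

section ConvexPoincare

open AffineMap Metric Module
open scoped ENNReal

variable {E : Type*} [NormedAddCommGroup E] [NormedSpace ℝ E]

theorem edist_le_lintegral_fderiv_lineMap {F : Type*} [NormedAddCommGroup F] [NormedSpace ℝ F]
    {f : E → F} (hf : ContDiff ℝ 1 f) (x y : E) :
    edist (f x) (f y) ≤ ∫⁻ t in Icc (0 : ℝ) 1, edist x y * ‖fderiv ℝ f (lineMap y x t)‖ₑ := by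
  have hline : ContDiff ℝ 1 (lineMap y x : ℝ → E) := by
    rw [funext (lineMap_apply_module' y x)]
    fun_prop
  have hderiv (t : ℝ) : deriv (f ∘ lineMap y x) t = fderiv ℝ f (lineMap y x t) (x - y) :=
    ((hf.differentiable one_ne_zero _).hasFDerivAt.comp_hasDerivAt t hasDerivAt_lineMap).deriv
  calc edist (f x) (f y) ≤ ∫⁻ t in Icc (0 : ℝ) 1, ‖deriv (f ∘ lineMap y x) t‖ₑ := by
        simpa [edist_eq_enorm_sub] using
          enorm_sub_le_lintegral_deriv_of_contDiffOn_Icc (hf.comp hline).contDiffOn zero_le_one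
    _ ≤ ∫⁻ t in Icc (0 : ℝ) 1, edist x y * ‖fderiv ℝ f (lineMap y x t)‖ₑ := by
        refine lintegral_mono fun t => ?_
        rw [hderiv, mul_comm, edist_eq_enorm_sub]
        exact ContinuousLinearMap.le_opENorm _ _

variable [FiniteDimensional ℝ E] [MeasurableSpace E] [BorelSpace E] {μ : Measure E}
  [μ.IsAddHaarMeasure] {s : Set E} {h : E → ℝ≥0∞}

theorem lintegral_comp_lineMap (hh : Measurable h) (y : E) {t : ℝ} (ht : t ≠ 0) :
    ∫⁻ x, h (lineMap y x t) ∂μ = ENNReal.ofReal |(t ^ finrank ℝ E)⁻¹| * ∫⁻ x, h x ∂μ := by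
  have hline (x : E) : lineMap y x t = (1 - t) • y + t • x := by
    rw [lineMap_apply_module]
  simp only [hline]
  rw [← lintegral_add_left_eq_self h ((1 - t) • y), ← smul_eq_mul, ← lintegral_smul_measure,
    ← Measure.map_addHaar_smul μ ht,
    lintegral_map (f := fun x => h ((1 - t) • y + x)) (hh.comp (measurable_const_add _))
      (measurable_const_smul t)]

theorem setLIntegral_comp_lineMap_le (hs : Convex ℝ s) (hsm : MeasurableSet s) (hh : Measurable h)
    {y : E} (hy : y ∈ s) {t : ℝ} (ht : t ∈ Icc (1 / 2) 1) :
    ∫⁻ x in s, h (lineMap y x t) ∂μ ≤ 2 ^ finrank ℝ E * ∫⁻ x in s, h x ∂μ := by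
  have ht₀ : 0 < t := one_half_pos.trans_le ht.1
  have hjacobian : ENNReal.ofReal |(t ^ finrank ℝ E)⁻¹| ≤ 2 ^ finrank ℝ E := by
    rw [abs_of_pos (by positivity), ← inv_pow, ENNReal.ofReal_pow (by positivity),
      ← ENNReal.ofReal_ofNat 2]
    gcongr
    exact (inv_le_comm₀ ht₀ two_pos).2 (by simpa using ht.1)
  calc ∫⁻ x in s, h (lineMap y x t) ∂μ ≤ ∫⁻ x in s, s.indicator h (lineMap y x t) ∂μ := by
        refine setLIntegral_mono' hsm fun x hx => ?_
        rw [indicator_of_mem (hs.lineMap_mem hy hx ⟨ht₀.le, ht.2⟩)]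
    _ ≤ ∫⁻ x, s.indicator h (lineMap y x t) ∂μ := setLIntegral_le_lintegral _ _
    _ = ENNReal.ofReal |(t ^ finrank ℝ E)⁻¹| * ∫⁻ x in s, h x ∂μ := by
        rw [lintegral_comp_lineMap (hh.indicator hsm) y ht₀.ne', lintegral_indicator hsm]
    _ ≤ 2 ^ finrank ℝ E * ∫⁻ x in s, h x ∂μ := by gcongr

theorem lintegral_lintegral_comp_lineMap_le (hs : Convex ℝ s) (hsm : MeasurableSet s)
    (hh : Measurable h) {t : ℝ} (ht : t ∈ Icc (0 : ℝ) 1) :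
    ∫⁻ y in s, ∫⁻ x in s, h (lineMap y x t) ∂μ ∂μ ≤
      2 ^ finrank ℝ E * μ s * ∫⁻ x in s, h x ∂μ := by
  wlog hhalf : 1 / 2 ≤ t generalizing t
  · have hsymm : 1 - t ∈ Icc (0 : ℝ) 1 := ⟨by linarith [ht.2], by linarith [ht.1]⟩
    rw [lintegral_lintegral_swap (by
      simp only [lineMap_apply_module]
      exact (hh.comp (by fun_prop)).aemeasurable)]
    simpa only [lineMap_apply_one_sub] using this hsymm (by linarith)
  calc ∫⁻ y in s, ∫⁻ x in s, h (lineMap y x t) ∂μ ∂μ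
      ≤ ∫⁻ _ in s, 2 ^ finrank ℝ E * ∫⁻ x in s, h x ∂μ ∂μ :=
        setLIntegral_mono' hsm fun y hy => setLIntegral_comp_lineMap_le hs hsm hh hy ⟨hhalf, ht.2⟩
    _ = 2 ^ finrank ℝ E * μ s * ∫⁻ x in s, h x ∂μ := by rw [setLIntegral_const, mul_right_comm]

theorem lintegral_lintegral_lintegral_lineMap_le (hs : Convex ℝ s) (hsm : MeasurableSet s)
    (hh : Measurable h) :
    ∫⁻ y in s, ∫⁻ x in s, (∫⁻ t in Icc (0 : ℝ) 1, h (lineMap y x t)) ∂μ ∂μ ≤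
      2 ^ finrank ℝ E * μ s * ∫⁻ x in s, h x ∂μ := by
  have hmeas : Measurable fun p : (E × ℝ) × E => h (lineMap p.1.1 p.2 p.1.2) := by
    simp only [lineMap_apply_module]
    exact hh.comp (by fun_prop)
  calc ∫⁻ y in s, ∫⁻ x in s, (∫⁻ t in Icc (0 : ℝ) 1, h (lineMap y x t)) ∂μ ∂μ
      = ∫⁻ t in Icc (0 : ℝ) 1, ∫⁻ y in s, ∫⁻ x in s, h (lineMap y x t) ∂μ ∂μ := by
        refine (lintegral_congr fun y => lintegral_lintegral_swap ?_).trans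
          (lintegral_lintegral_swap hmeas.lintegral_prod_right'.aemeasurable)
        exact (hmeas.comp (f := fun p : E × ℝ => ((y, p.2), p.1)) (by fun_prop)).aemeasurable
    _ ≤ ∫⁻ _ in Icc (0 : ℝ) 1, 2 ^ finrank ℝ E * μ s * ∫⁻ x in s, h x ∂μ :=
        setLIntegral_mono' measurableSet_Icc fun t ht =>
          lintegral_lintegral_comp_lineMap_le hs hsm hh ht
    _ = 2 ^ finrank ℝ E * μ s * ∫⁻ x in s, h x ∂μ := by simp

theorem totalOscillation_restrict_le_of_contDiff {F : Type*} [NormedAddCommGroup F]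
    [NormedSpace ℝ F] (hs : Convex ℝ s) (hsm : MeasurableSet s) {f : E → F}
    (hf : ContDiff ℝ 1 f) :
    totalOscillation (μ.restrict s) f ≤
      2 ^ finrank ℝ E * μ s * ∫⁻ x in s, ediam s * ‖fderiv ℝ f x‖ₑ ∂μ := by
  calc totalOscillation (μ.restrict s) f
      ≤ ∫⁻ y in s, ∫⁻ x in s,
          (∫⁻ t in Icc (0 : ℝ) 1, ediam s * ‖fderiv ℝ f (lineMap y x t)‖ₑ) ∂μ ∂μ := by
        refine setLIntegral_mono' hsm fun y hy => setLIntegral_mono' hsm fun x hx => ?_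
        refine (edist_le_lintegral_fderiv_lineMap hf x y).trans ?_
        gcongr
        exact edist_le_ediam_of_mem hx hy
    _ ≤ 2 ^ finrank ℝ E * μ s * ∫⁻ x in s, ediam s * ‖fderiv ℝ f x‖ₑ ∂μ :=
        lintegral_lintegral_lintegral_lineMap_le hs hsm
          ((hf.continuous_fderiv one_ne_zero).enorm.measurable.const_mul _)

end ConvexPoincare

section Mollification

open ContinuousLinearMap Filter Metric Module
open scoped Convolution Topology

theorem lintegral_lintegral_mul_comp_sub {G : Type*} [AddGroup G] [MeasurableSpace G]
    [MeasurableAdd G] [MeasurableSub₂ G] {μ ν : Measure G} [SFinite μ] [μ.IsAddRightInvariant]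
    [SFinite ν] {w k : G → ENNReal} (hw : AEMeasurable w ν) (hk : Measurable k) :
    ∫⁻ x, ∫⁻ t, w t * k (x - t) ∂ν ∂μ = (∫⁻ t, w t ∂ν) * ∫⁻ x, k x ∂μ := by
  calc ∫⁻ x, ∫⁻ t, w t * k (x - t) ∂ν ∂μ = ∫⁻ t, ∫⁻ x, w t * k (x - t) ∂μ ∂ν :=
        lintegral_lintegral_swap
          (hw.comp_snd.mul (hk.comp measurable_sub).aemeasurable)
    _ = ∫⁻ t, w t * ∫⁻ x, k x ∂μ ∂ν := by
        refine lintegral_congr fun t => ?_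
        rw [lintegral_const_mul _ (show Measurable fun x => k (x - t) by fun_prop),
          lintegral_sub_right_eq_self k t]
    _ = (∫⁻ t, w t ∂ν) * ∫⁻ x, k x ∂μ := lintegral_mul_const'' _ hw

theorem fderiv_convolution_lsmul_apply {E F : Type*} [NormedAddCommGroup E] [NormedSpace ℝ E]
    [MeasurableSpace E] [BorelSpace E] [NormedAddCommGroup F] [NormedSpace ℝ F] {μ : Measure E}
    [SFinite μ] [μ.IsAddLeftInvariant] [μ.IsNegInvariant] {η : E → ℝ} (hη : ContDiff ℝ 1 η)
    (hηc : HasCompactSupport η) {g : E → F} (hg : LocallyIntegrable g μ) (x v : E) :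
    fderiv ℝ (η ⋆[lsmul ℝ ℝ, μ] g) x v =
      -∫ t, fderiv ℝ (fun t => η (x - t)) t v • g t ∂μ := by
  have hreflect (t : E) : fderiv ℝ (fun t => η (x - t)) t v = -fderiv ℝ η (x - t) v := by
    have := (hη.differentiable one_ne_zero (x - t)).hasFDerivAt.comp t
      ((hasFDerivAt_id t).const_sub x)
    rw [show (fun t => η (x - t)) = η ∘ (x - ·) from rfl, this.fderiv]
    simp
  have hderiv := hηc.hasFDerivAt_convolution_right (lsmul ℝ ℝ).flip hg hη x
  rw [convolution_flip] at hderiv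
  rw [hderiv.fderiv, convolution_precompR_apply _ hg (hηc.fderiv ℝ)
    (hη.continuous_fderiv one_ne_zero), convolution_def, ← integral_neg]
  simp only [hreflect, neg_smul, neg_neg, flip_apply, lsmul_apply]

variable {m : ℕ} {V K : Set (EuclideanSpace ℝ (Fin m))} {f : EuclideanSpace ℝ (Fin m) → ℝ}
  {F : EuclideanSpace ℝ (Fin m) → (EuclideanSpace ℝ (Fin m) →L[ℝ] ℝ)}

theorem HasWeakFDerivOn.integral_mul_fderiv_eq (hf : HasWeakFDerivOn V f F)
    {φ : EuclideanSpace ℝ (Fin m) → ℝ} (hφ : ContDiff ℝ ∞ φ) (hφc : HasCompactSupport φ)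
    (hφV : tsupport φ ⊆ V) (v : EuclideanSpace ℝ (Fin m)) :
    ∫ y, f y * fderiv ℝ φ y v = -∫ y, F y v * φ y := by
  have hleft : ∫ y in V, f y * fderiv ℝ φ y v = ∫ y, f y * fderiv ℝ φ y v :=
    setIntegral_eq_integral_of_forall_compl_eq_zero fun y hy => by
      rw [fderiv_of_notMem_tsupport ℝ (notMem_subset hφV hy), zero_apply, mul_zero]
  have hright : ∫ y in V, F y v * φ y = ∫ y, F y v * φ y :=
    setIntegral_eq_integral_of_forall_compl_eq_zero fun y hy => by
      rw [image_eq_zero_of_notMem_tsupport (notMem_subset hφV hy), mul_zero]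
  rw [← hleft, ← hright, hf.integral_eq φ hφ hφc hφV v]

theorem HasWeakFDerivOn.integrable_indicator (hf : HasWeakFDerivOn V f F) (hK : IsCompact K)
    (hKV : K ⊆ V) : Integrable (K.indicator f) :=
  (integrable_indicator_iff hK.measurableSet).2
    (hf.locallyIntegrableOn.integrableOn_compact_subset hKV hK)

theorem HasWeakFDerivOn.fderiv_convolution_apply (hf : HasWeakFDerivOn V f F) (hK : IsCompact K)
    (hKV : K ⊆ V) {η : EuclideanSpace ℝ (Fin m) → ℝ} (hη : ContDiff ℝ ∞ η)
    (hηc : HasCompactSupport η) {x : EuclideanSpace ℝ (Fin m)}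
    (hx : (x - ·) ⁻¹' tsupport η ⊆ K) (v : EuclideanSpace ℝ (Fin m)) :
    fderiv ℝ (η ⋆[lsmul ℝ ℝ, volume] K.indicator f) x v = ∫ t in K, F t v * η (x - t) := by
  set φ : EuclideanSpace ℝ (Fin m) → ℝ := fun t => η (x - t)
  have hφ : ContDiff ℝ ∞ φ := hη.comp (contDiff_const.sub contDiff_id)
  have hφK : tsupport φ ⊆ K := (tsupport_comp_subset_preimage η (by fun_prop)).trans hx
  have hφc : HasCompactSupport φ := hK.of_isClosed_subset (isClosed_tsupport φ) hφK
  calc fderiv ℝ (η ⋆[lsmul ℝ ℝ, volume] K.indicator f) x v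
      = -∫ t, fderiv ℝ φ t v • K.indicator f t :=
        fderiv_convolution_lsmul_apply (hη.of_le (by simp)) hηc
          (hf.integrable_indicator hK hKV).locallyIntegrable x v
    _ = -∫ t, f t * fderiv ℝ φ t v := by
        congr 2 with t
        by_cases ht : t ∈ K
        · rw [indicator_of_mem ht, smul_eq_mul, mul_comm]
        · rw [fderiv_of_notMem_tsupport ℝ (notMem_subset hφK ht), zero_apply, zero_smul, mul_zero]
    _ = ∫ t, F t v * φ t := by
        rw [hf.integral_mul_fderiv_eq hφ hφc (hφK.trans hKV), neg_neg]
    _ = ∫ t in K, F t v * η (x - t) := by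
        refine (setIntegral_eq_integral_of_forall_compl_eq_zero fun t ht => ?_).symm
        rw [image_eq_zero_of_notMem_tsupport (f := φ) (notMem_subset hφK ht), mul_zero]

theorem HasWeakFDerivOn.enorm_fderiv_convolution_le (hf : HasWeakFDerivOn V f F)
    (hK : IsCompact K) (hKV : K ⊆ V) {η : EuclideanSpace ℝ (Fin m) → ℝ} (hη : ContDiff ℝ ∞ η)
    (hηc : HasCompactSupport η) {x : EuclideanSpace ℝ (Fin m)}
    (hx : (x - ·) ⁻¹' tsupport η ⊆ K) :
    ‖fderiv ℝ (η ⋆[lsmul ℝ ℝ, volume] K.indicator f) x‖ₑ ≤ ∫⁻ t in K, ‖F t‖ₑ * ‖η (x - t)‖ₑ := by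
  refine opENorm_le_bound _ fun v => ?_
  rw [hf.fderiv_convolution_apply hK hKV hη hηc hx, ← lintegral_mul_const' _ _ enorm_ne_top]
  refine (enorm_integral_le_lintegral_enorm _).trans (lintegral_mono fun t => ?_)
  rw [enorm_mul, mul_right_comm]
  gcongr
  exact le_opENorm _ _

theorem HasWeakFDerivOn.lintegral_enorm_fderiv_convolution_le (hf : HasWeakFDerivOn V f F)
    (hK : IsCompact K) (hKV : K ⊆ V) {η : EuclideanSpace ℝ (Fin m) → ℝ} (hη : ContDiff ℝ ∞ η)
    (hηc : HasCompactSupport η) {s : Set (EuclideanSpace ℝ (Fin m))} (hsm : MeasurableSet s)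
    (hs : ∀ x ∈ s, (x - ·) ⁻¹' tsupport η ⊆ K) :
    ∫⁻ x in s, ‖fderiv ℝ (η ⋆[lsmul ℝ ℝ, volume] K.indicator f) x‖ₑ ≤
      (∫⁻ t in K, ‖F t‖ₑ) * ∫⁻ t, ‖η t‖ₑ := by
  have hF : AEMeasurable (fun t => ‖F t‖ₑ) (volume.restrict K) :=
    (hf.locallyIntegrableOn_deriv.integrableOn_compact_subset hKV hK).1.enorm
  calc ∫⁻ x in s, ‖fderiv ℝ (η ⋆[lsmul ℝ ℝ, volume] K.indicator f) x‖ₑ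
      ≤ ∫⁻ x in s, ∫⁻ t in K, ‖F t‖ₑ * ‖η (x - t)‖ₑ := setLIntegral_mono' hsm fun x hx =>
        hf.enorm_fderiv_convolution_le hK hKV hη hηc (hs x hx)
    _ ≤ ∫⁻ x, ∫⁻ t in K, ‖F t‖ₑ * ‖η (x - t)‖ₑ := setLIntegral_le_lintegral _ _
    _ = (∫⁻ t in K, ‖F t‖ₑ) * ∫⁻ t, ‖η t‖ₑ :=
        lintegral_lintegral_mul_comp_sub hF hη.continuous.enorm.measurable

theorem lintegral_enorm_contDiffBump_normed {E : Type*} [NormedAddCommGroup E] [NormedSpace ℝ E]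
    [HasContDiffBump E] [FiniteDimensional ℝ E] [MeasurableSpace E] [BorelSpace E] {μ : Measure E}
    [IsLocallyFiniteMeasure μ] [μ.IsOpenPosMeasure] {c : E} (φ : ContDiffBump c) :
    ∫⁻ x, ‖φ.normed μ x‖ₑ ∂μ = 1 := by
  rw [← ofReal_integral_norm_eq_lintegral_enorm φ.integrable_normed]
  simp only [Real.norm_of_nonneg (φ.nonneg_normed _), φ.integral_normed, ENNReal.ofReal_one]

variable {s : Set (EuclideanSpace ℝ (Fin m))} {δ : ℝ}

theorem HasWeakFDerivOn.totalOscillation_normed_convolution_le (hf : HasWeakFDerivOn V f F)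
    (hs : Convex ℝ s) (hsm : MeasurableSet s) (hsb : Bornology.IsBounded s)
    (hsV : cthickening δ s ⊆ V) (φ : ContDiffBump (0 : EuclideanSpace ℝ (Fin m)))
    (hφ : φ.rOut ≤ δ) :
    totalOscillation (volume.restrict s)
        (φ.normed volume ⋆[lsmul ℝ ℝ, volume] (cthickening δ s).indicator f) ≤
      2 ^ m * volume s * (ediam s * ∫⁻ x in cthickening δ s, ‖F x‖ₑ) := by
  have hK : IsCompact (cthickening δ s) :=
    isCompact_of_isClosed_isBounded isClosed_cthickening hsb.cthickening
  have hsupport (x) (hx : x ∈ s) :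
      (x - ·) ⁻¹' tsupport (φ.normed volume) ⊆ cthickening δ s := fun t ht => by
    rw [φ.tsupport_normed_eq, mem_preimage, mem_closedBall_zero_iff, ← dist_eq_norm,
      dist_comm] at ht
    exact closedBall_subset_cthickening hx δ (ht.trans hφ)
  have hsmooth : ContDiff ℝ 1
      (φ.normed volume ⋆[lsmul ℝ ℝ, volume] (cthickening δ s).indicator f) :=
    φ.hasCompactSupport_normed.contDiff_convolution_left _ φ.contDiff_normed
      (hf.integrable_indicator hK hsV).locallyIntegrable
  refine (totalOscillation_restrict_le_of_contDiff hs hsm hsmooth).trans ?_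
  rw [finrank_euclideanSpace_fin, lintegral_const_mul' _ _ hsb.ediam_ne_top]
  gcongr 2 ^ m * _ * (_ * ?_)
  simpa only [lintegral_enorm_contDiffBump_normed, mul_one] using
    hf.lintegral_enorm_fderiv_convolution_le hK hsV φ.contDiff_normed φ.hasCompactSupport_normed
      hsm hsupport

theorem exists_contDiffBump_seq {E : Type*} [NormedAddCommGroup E] [NormedSpace ℝ E] (c : E)
    (hδ : 0 < δ) :
    ∃ φ : ℕ → ContDiffBump c, Tendsto (fun n => (φ n).rOut) atTop (𝓝 0) ∧
      ∀ n, (φ n).rOut ≤ δ ∧ (φ n).rOut = 2 * (φ n).rIn := by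
  have hpos (n : ℕ) : 0 < δ / (n + 1) := by positivity
  refine ⟨fun n => ⟨δ / (n + 1) / 2, δ / (n + 1), half_pos (hpos n), half_lt_self (hpos n)⟩,
    mod_cast (tendsto_const_div_atTop_nhds_zero_nat δ).comp (tendsto_add_atTop_nat 1),
    fun n => ⟨div_le_self hδ.le (by simp), (mul_div_cancel₀ _ two_ne_zero).symm⟩⟩

theorem HasWeakFDerivOn.totalOscillation_le (hf : HasWeakFDerivOn V f F) (hs : Convex ℝ s)
    (hsm : MeasurableSet s) (hsb : Bornology.IsBounded s) (hδ : 0 < δ)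
    (hsV : cthickening δ s ⊆ V) :
    totalOscillation (volume.restrict s) f ≤
      2 ^ m * volume s * (ediam s * ∫⁻ x in cthickening δ s, ‖F x‖ₑ) := by
  have hK : IsCompact (cthickening δ s) :=
    isCompact_of_isClosed_isBounded isClosed_cthickening hsb.cthickening
  have hint := (hf.integrable_indicator hK hsV).locallyIntegrable
  obtain ⟨φ, hφ₀, hφ⟩ := exists_contDiffBump_seq (0 : EuclideanSpace ℝ (Fin m)) hδ
  have hlim := ContDiffBump.ae_convolution_tendsto_right_of_locallyIntegrable hφ₀
    (.of_forall fun n => (hφ n).2.le) hint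
  refine totalOscillation_le_of_tendsto (fun n => ?_) ?_ fun n =>
    hf.totalOscillation_normed_convolution_le hs hsm hsb hsV (φ n) (hφ n).1
  · exact ((φ n).hasCompactSupport_normed.continuous_convolution_left _ (φ n).continuous_normed
      hint).aemeasurable
  · filter_upwards [ae_restrict_of_ae hlim, ae_restrict_mem hsm] with x hx hxs
    rwa [indicator_of_mem (self_subset_cthickening s hxs)] at hx

end Mollification

section HausdorffMeasure

open scoped ENNReal NNReal Topology

variable {X Y : Type*} [EMetricSpace X] [EMetricSpace Y] [MeasurableSpace X] [BorelSpace X]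
  [MeasurableSpace Y] [BorelSpace Y] {K : ℝ≥0} {f : X → Y} {s : Set X}

theorem euclideanHausdorffMeasure_image_le (hf : LipschitzOnWith K f s) (d : ℕ) :
    Measure.euclideanHausdorffMeasure d (f '' s) ≤
      (K : ℝ≥0∞) ^ d * Measure.euclideanHausdorffMeasure d s := by
  simp only [Measure.euclideanHausdorffMeasure_def, Measure.smul_apply]
  rw [mul_smul_comm]
  gcongr
  simpa using hf.hausdorffMeasure_image_le (d := d) (Nat.cast_nonneg d)

theorem le_euclideanHausdorffMeasure_image (hf : AntilipschitzWith K (s.domRestrict f)) (d : ℕ) :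
    Measure.euclideanHausdorffMeasure d s ≤
      (K : ℝ≥0∞) ^ d * Measure.euclideanHausdorffMeasure d (f '' s) := by
  have hs : Measure.hausdorffMeasure (d : ℝ) (univ : Set s) =
      Measure.hausdorffMeasure (d : ℝ) s := by
    simpa using
      ((isometry_subtype_coe (s := s)).hausdorffMeasure_image (Or.inl d.cast_nonneg) univ).symm
  simp only [Measure.euclideanHausdorffMeasure_def, Measure.smul_apply]
  rw [mul_smul_comm]
  gcongr
  simpa [hs, range_domRestrict] using hf.le_hausdorffMeasure_image (d := d) (Nat.cast_nonneg d) univ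

theorem restrict_euclideanHausdorffMeasure_image_le (hf : LipschitzOnWith K f s)
    (hs : MeasurableSet s) (d : ℕ) :
    (Measure.euclideanHausdorffMeasure d).restrict (f '' s) ≤
      (K : ℝ≥0∞) ^ d • ((Measure.euclideanHausdorffMeasure d).restrict s).map f := by
  refine Measure.le_iff.2 fun A hA => ?_
  rw [Measure.restrict_apply hA, Measure.smul_apply,
    Measure.map_apply_of_aemeasurable (hf.continuousOn.aemeasurable hs) hA,
    Measure.restrict_apply' hs, inter_comm A, ← image_inter_preimage, inter_comm s]
  exact euclideanHausdorffMeasure_image_le (hf.mono inter_subset_right) d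

theorem map_restrict_euclideanHausdorffMeasure_le (hf : AntilipschitzWith K (s.domRestrict f))
    (hc : ContinuousOn f s) (hs : MeasurableSet s) (d : ℕ) :
    ((Measure.euclideanHausdorffMeasure d).restrict s).map f ≤
      (K : ℝ≥0∞) ^ d • (Measure.euclideanHausdorffMeasure d).restrict (f '' s) := by
  refine Measure.le_iff.2 fun A hA => ?_
  rw [Measure.smul_apply, Measure.map_apply_of_aemeasurable (hc.aemeasurable hs) hA,
    Measure.restrict_apply hA, Measure.restrict_apply' hs, inter_comm A, ← image_inter_preimage,
    inter_comm _ s]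
  exact le_euclideanHausdorffMeasure_image
    (fun x y => hf ⟨x, x.2.1⟩ ⟨y, y.2.1⟩) d

theorem exists_lipschitzOnWith_antilipschitzWith_of_hasStrictFDerivAt {E F : Type*}
    [NormedAddCommGroup E] [NormedSpace ℝ E] [FiniteDimensional ℝ E]
    [NormedAddCommGroup F] [NormedSpace ℝ F]
    {f : E → F} {f' : E →L[ℝ] F} {a : E} (hf : HasStrictFDerivAt f f' a)
    (hf' : Function.Injective f') :
    ∃ s ∈ 𝓝 a, ∃ K K' : ℝ≥0, LipschitzOnWith K f s ∧ AntilipschitzWith K' (s.domRestrict f) := by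
  obtain ⟨k, hk, hanti⟩ := f'.toLinearMap.injective_iff_antilipschitz.1 hf'
  obtain ⟨K, s, hs, hlip⟩ := hf.exists_lipschitzOnWith
  obtain ⟨t, ht, happrox⟩ := hf.approximates_deriv_on_nhds (c := k⁻¹ / 2)
    (Or.inr (by positivity))
  have hanti_t : AntilipschitzWith (k⁻¹ - k⁻¹ / 2)⁻¹ (t.domRestrict f) := fun x y => by
    simpa using (hanti.domRestrict t).add_lipschitzWith happrox.lipschitz_sub
      (NNReal.half_lt_self (inv_pos.2 hk).ne') x y
  exact ⟨s ∩ t, Filter.inter_mem hs ht, K, _, hlip.mono inter_subset_left,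
    fun x y => hanti_t ⟨x, x.2.2⟩ ⟨y, y.2.2⟩⟩

end HausdorffMeasure

section PushforwardBounds

open scoped ENNReal

variable {α β : Type*} [MeasurableSpace α] [MeasurableSpace β] {μ : Measure α} {ν : Measure β}
  {ψ : α → β} {c : ℝ≥0∞}

theorem totalOscillation_le_of_le_smul_map {X : Type*} [PseudoEMetricSpace X]
    [SecondCountableTopology X] [MeasurableSpace X] [OpensMeasurableSpace X] [SFinite μ]
    (hν : ν ≤ c • μ.map ψ) (hc : c ≠ ⊤) (hψ : AEMeasurable ψ μ) {f : β → X}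
    (hf : AEMeasurable f (μ.map ψ)) :
    totalOscillation ν f ≤ c ^ 2 * totalOscillation μ (f ∘ ψ) := by
  rw [← totalOscillation_map hψ hf, ← totalOscillation_smul_measure hc]
  exact totalOscillation_mono_measure hν f

theorem lintegral_comp_le_of_map_le_smul (hν : μ.map ψ ≤ c • ν) (hψ : AEMeasurable ψ μ)
    {h : β → ℝ≥0∞} (hh : AEMeasurable h ν) : ∫⁻ x, h (ψ x) ∂μ ≤ c * ∫⁻ y, h y ∂ν := by
  rw [← lintegral_map' ((hh.smul_measure c).mono_measure hν) hψ]
  simpa only [lintegral_smul_measure, smul_eq_mul] using lintegral_mono' hν fun y => le_refl (h y)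

end PushforwardBounds

section Charts

open scoped ENNReal NNReal

variable {N : ℕ} {M : Set (EuclideanSpace ℝ (Fin N))} {V : Set (EuclideanSpace ℝ (Fin (N - 1)))}
  {U : Set (EuclideanSpace ℝ (Fin N))}
  {ψ : EuclideanSpace ℝ (Fin (N - 1)) → EuclideanSpace ℝ (Fin N)}

namespace IsLocalParametrization

theorem image_subset (h : IsLocalParametrization M V U ψ) : ψ '' V ⊆ M :=
  h.image_eq.trans_subset inter_subset_left

theorem exists_lipschitzOnWith_antilipschitzWith (h : IsLocalParametrization M V U ψ)
    {y₀ : EuclideanSpace ℝ (Fin (N - 1))} (hy₀ : y₀ ∈ V) :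
    ∃ T ⊆ V, IsOpen T ∧ y₀ ∈ T ∧ ∃ K K' : ℝ≥0,
      LipschitzOnWith K ψ T ∧ AntilipschitzWith K' (T.domRestrict ψ) := by
  have hstrict : HasStrictFDerivAt ψ (fderiv ℝ ψ y₀) y₀ :=
    (h.contDiffOn.contDiffAt (h.isOpen_domain.mem_nhds hy₀)).hasStrictFDerivAt (by simp)
  obtain ⟨s, hs, K, K', hlip, hanti⟩ :=
    exists_lipschitzOnWith_antilipschitzWith_of_hasStrictFDerivAt hstrict
      (h.injective_fderiv y₀ hy₀)
  obtain ⟨T, hT, hTo, hyT⟩ := mem_nhds_iff.1 (Filter.inter_mem hs (h.isOpen_domain.mem_nhds hy₀))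
  exact ⟨T, fun y hy => (hT hy).2, hTo, hyT, K, K', hlip.mono fun y hy => (hT hy).1,
    fun x y => hanti ⟨x, (hT x.2).1⟩ ⟨y, (hT y.2).1⟩⟩

theorem exists_isOpen_image_eq (h : IsLocalParametrization M V U ψ)
    {s : Set (EuclideanSpace ℝ (Fin (N - 1)))} (hs : IsOpen s) (hsV : s ⊆ V) :
    ∃ O, IsOpen O ∧ ψ '' s = M ∩ O := by
  obtain ⟨χ, hχ, hinv⟩ := h.exists_continuous_inverse
  obtain ⟨O, hO, hOs⟩ := continuousOn_iff'.1 hχ s hs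
  refine ⟨O ∩ U, hO.inter h.isOpen_target, ?_⟩
  calc ψ '' s = χ ⁻¹' s ∩ ψ '' V := by rw [← hinv.image_inter', inter_eq_left.2 hsV]
    _ = O ∩ (M ∩ U) := by rw [h.image_eq, hOs]
    _ = M ∩ (O ∩ U) := inter_left_comm O M U

end IsLocalParametrization

theorem enorm_innerSL_comp_le {E F : Type*} [NormedAddCommGroup E] [NormedSpace ℝ E]
    [NormedAddCommGroup F] [InnerProductSpace ℝ F] (w : F) (L : E →L[ℝ] F) :
    ‖(innerSL ℝ w).comp L‖ₑ ≤ ‖L‖ₑ * ‖w‖ₑ := by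
  have hnorm : ‖(innerSL ℝ w).comp L‖ ≤ ‖L‖ * ‖w‖ := by
    simpa [mul_comm] using (innerSL ℝ w).opNorm_comp_le L
  simp only [enorm_eq_nnnorm, ← ENNReal.coe_mul, ENNReal.coe_le_coe]
  exact hnorm

theorem map_volume_restrict_le_smul_surfaceMeasure {K : ℝ≥0}
    {s : Set (EuclideanSpace ℝ (Fin (N - 1)))} (hψ : AntilipschitzWith K (s.domRestrict ψ))
    (hc : ContinuousOn ψ s) (hs : MeasurableSet s) (hsM : ψ '' s ⊆ M) :
    (volume.restrict s).map ψ ≤ (K : ℝ≥0∞) ^ (N - 1) • surfaceMeasure M := by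
  rw [← EuclideanSpace.euclideanHausdorffMeasure_eq_volume]
  exact (map_restrict_euclideanHausdorffMeasure_le hψ hc hs (N - 1)).trans
    (smul_mono_right _ (Measure.restrict_mono_set _ hsM))

theorem surfaceMeasure_restrict {O : Set (EuclideanSpace ℝ (Fin N))} (hO : MeasurableSet O) :
    (surfaceMeasure M).restrict O =
      (Measure.euclideanHausdorffMeasure (N - 1)).restrict (M ∩ O) := by
  rw [surfaceMeasure, Measure.restrict_restrict hO, inter_comm]

theorem IsSmoothHypersurface.surfaceMeasure_ne_zero (hM : IsSmoothHypersurface M)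
    {O : Set (EuclideanSpace ℝ (Fin N))} (hO : IsOpen O) (hMO : (M ∩ O).Nonempty) :
    surfaceMeasure M O ≠ 0 := by
  obtain ⟨p, hpM, hpO⟩ := hMO
  obtain ⟨V, U, ψ, h, hpU⟩ := hM p hpM
  obtain ⟨y₀, hy₀, rfl⟩ : p ∈ ψ '' V := h.image_eq ▸ ⟨hpM, hpU⟩
  obtain ⟨T, hTV, hTo, hyT, K, K', hlip, hanti⟩ := h.exists_lipschitzOnWith_antilipschitzWith hy₀
  have hpre : IsOpen (T ∩ ψ ⁻¹' O) := hlip.continuousOn.isOpen_inter_preimage hTo hO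
  have hle := map_volume_restrict_le_smul_surfaceMeasure hanti hlip.continuousOn hTo.measurableSet
    ((image_mono hTV).trans h.image_subset) O
  rw [Measure.map_apply_of_aemeasurable (hlip.continuousOn.aemeasurable hTo.measurableSet)
    hO.measurableSet, Measure.restrict_apply' hTo.measurableSet, inter_comm] at hle
  exact right_ne_zero_of_mul ((hpre.measure_pos volume ⟨y₀, hyT, hpO⟩).trans_le hle).ne'

end Charts

section PoincareSets

open scoped ENNReal NNReal

variable {N : ℕ} {M : Set (EuclideanSpace ℝ (Fin N))} {V : Set (EuclideanSpace ℝ (Fin (N - 1)))}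
  {U : Set (EuclideanSpace ℝ (Fin N))}
  {ψ : EuclideanSpace ℝ (Fin (N - 1)) → EuclideanSpace ℝ (Fin N)}

/-- A set of finite surface measure on which the total oscillation of every `u ∈ W^{1,1}(M)` is
controlled by the `L¹` norm of its gradient. That norm is taken over all of `M` and not only over
`M ∩ O`: a local estimate would have to enlarge `O`, and the weaker bound suffices for gluing. -/
def IsPoincareSet (M O : Set (EuclideanSpace ℝ (Fin N))) : Prop :=
  surfaceMeasure M O ≠ ⊤ ∧ ∃ C : ℝ≥0∞, C ≠ ⊤ ∧ ∀ u g, MemW11 M u g →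
    totalOscillation ((surfaceMeasure M).restrict O) u ≤ C * ∫⁻ x, ‖g x‖ₑ ∂surfaceMeasure M

theorem IsPoincareSet.union {O O' : Set (EuclideanSpace ℝ (Fin N))} (hO : IsPoincareSet M O)
    (hO' : IsPoincareSet M O') (hoverlap : surfaceMeasure M (O ∩ O') ≠ 0) :
    IsPoincareSet M (O ∪ O') := by
  obtain ⟨hfin, C, hC, hosc⟩ := hO
  obtain ⟨hfin', C', hC', hosc'⟩ := hO'
  set S := surfaceMeasure M
  have : IsFiniteMeasure (S.restrict O) := isFiniteMeasure_restrict.2 hfin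
  have : IsFiniteMeasure (S.restrict O') := isFiniteMeasure_restrict.2 hfin'
  refine ⟨measure_union_ne_top hfin hfin',
    C + C' + 2 * ((S (O ∩ O'))⁻¹ * (S O * C' + S O' * C)), by finiteness, fun u g hu => ?_⟩
  have hum : AEMeasurable u S := hu.memLp.1.aemeasurable
  have hadd := totalOscillation_add_measure_le (Measure.restrict_mono_set S inter_subset_left)
    (Measure.restrict_mono_set S inter_subset_right) (Measure.restrict_eq_zero.not.2 hoverlap)
    (hum.restrict (s := O)) (hum.restrict (s := O'))
  simp only [Measure.restrict_apply_univ] at hadd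
  set G := ∫⁻ x, ‖g x‖ₑ ∂S
  calc totalOscillation (S.restrict (O ∪ O')) u
      ≤ totalOscillation (S.restrict O + S.restrict O') u :=
        totalOscillation_mono_measure (Measure.restrict_union_le O O') u
    _ ≤ _ := hadd
    _ ≤ C * G + C' * G + 2 * ((S (O ∩ O'))⁻¹ * (S O * (C' * G) + S O' * (C * G))) := by
        have h := hosc u g hu
        have h' := hosc' u g hu
        gcongr
    _ = _ := by ring

theorem lintegral_enorm_gradient_comp_le {K K' : ℝ≥0} {s T : Set (EuclideanSpace ℝ (Fin (N - 1)))}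
    (hT : IsOpen T) (hTM : ψ '' T ⊆ M) (hlip : LipschitzOnWith K ψ T)
    (hanti : AntilipschitzWith K' (T.domRestrict ψ)) (hsT : s ⊆ T)
    {g : EuclideanSpace ℝ (Fin N) → EuclideanSpace ℝ (Fin N)}
    (hg : AEMeasurable g (surfaceMeasure M)) :
    ∫⁻ y in s, ‖(innerSL ℝ (g (ψ y))).comp (fderiv ℝ ψ y)‖ₑ ≤
      K * ((K' : ℝ≥0∞) ^ (N - 1) * ∫⁻ x, ‖g x‖ₑ ∂surfaceMeasure M) := by
  calc ∫⁻ y in s, ‖(innerSL ℝ (g (ψ y))).comp (fderiv ℝ ψ y)‖ₑ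
      ≤ ∫⁻ y in T, ‖(innerSL ℝ (g (ψ y))).comp (fderiv ℝ ψ y)‖ₑ := lintegral_mono_set hsT
    _ ≤ ∫⁻ y in T, K * ‖g (ψ y)‖ₑ := by
        refine setLIntegral_mono' hT.measurableSet fun y hy => ?_
        refine (enorm_innerSL_comp_le _ _).trans (mul_le_mul_left ?_ _)
        exact_mod_cast norm_fderiv_le_of_lipschitzOn ℝ (hT.mem_nhds hy) hlip
    _ = K * ∫⁻ y in T, ‖g (ψ y)‖ₑ := lintegral_const_mul' _ _ ENNReal.coe_ne_top
    _ ≤ _ := by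
        gcongr
        exact lintegral_comp_le_of_map_le_smul
          (map_volume_restrict_le_smul_surfaceMeasure hanti hlip.continuousOn hT.measurableSet hTM)
          (hlip.continuousOn.aemeasurable hT.measurableSet) hg.enorm

theorem IsLocalParametrization.totalOscillation_le (h : IsLocalParametrization M V U ψ)
    {K K' : ℝ≥0} {s T : Set (EuclideanSpace ℝ (Fin (N - 1)))} (hTV : T ⊆ V) (hT : IsOpen T)
    (hlip : LipschitzOnWith K ψ T) (hanti : AntilipschitzWith K' (T.domRestrict ψ))
    (hs : Convex ℝ s) (hsm : MeasurableSet s) (hsb : Bornology.IsBounded s) {δ : ℝ} (hδ : 0 < δ)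
    (hsT : Metric.cthickening δ s ⊆ T) {u : EuclideanSpace ℝ (Fin N) → ℝ}
    {g : EuclideanSpace ℝ (Fin N) → EuclideanSpace ℝ (Fin N)} (hu : MemW11 M u g) :
    totalOscillation ((Measure.euclideanHausdorffMeasure (N - 1)).restrict (ψ '' s)) u ≤
      ((K : ℝ≥0∞) ^ (N - 1)) ^ 2 * (2 ^ (N - 1) * volume s * (Metric.ediam s *
        (K * ((K' : ℝ≥0∞) ^ (N - 1) * ∫⁻ x, ‖g x‖ₑ ∂surfaceMeasure M)))) := by
  have hsT' : s ⊆ T := (Metric.self_subset_cthickening s).trans hsT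
  have hTM : ψ '' T ⊆ M := (image_mono hTV).trans h.image_subset
  have hle : (Measure.euclideanHausdorffMeasure (N - 1)).restrict (ψ '' s) ≤
      (K : ℝ≥0∞) ^ (N - 1) • (volume.restrict s).map ψ := by
    rw [← EuclideanSpace.euclideanHausdorffMeasure_eq_volume]
    exact restrict_euclideanHausdorffMeasure_image_le (hlip.mono hsT') hsm (N - 1)
  have hge : (volume.restrict s).map ψ ≤ (K' : ℝ≥0∞) ^ (N - 1) • surfaceMeasure M :=
    map_volume_restrict_le_smul_surfaceMeasure (fun x y => hanti ⟨x, hsT' x.2⟩ ⟨y, hsT' y.2⟩)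
      (hlip.continuousOn.mono hsT') hsm ((image_mono hsT').trans hTM)
  calc totalOscillation ((Measure.euclideanHausdorffMeasure (N - 1)).restrict (ψ '' s)) u
      ≤ ((K : ℝ≥0∞) ^ (N - 1)) ^ 2 * totalOscillation (volume.restrict s) (u ∘ ψ) :=
        totalOscillation_le_of_le_smul_map hle (by finiteness)
          ((hlip.continuousOn.mono hsT').aemeasurable hsm)
          ((hu.memLp.1.aemeasurable.smul_measure _).mono_measure hge)
    _ ≤ ((K : ℝ≥0∞) ^ (N - 1)) ^ 2 * (2 ^ (N - 1) * volume s * (Metric.ediam s *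
          ∫⁻ y in Metric.cthickening δ s, ‖(innerSL ℝ (g (ψ y))).comp (fderiv ℝ ψ y)‖ₑ)) := by
        gcongr
        exact (hu.hasWeakTangentialGradient.weak_deriv V U ψ h).totalOscillation_le hs hsm hsb hδ
          (hsT.trans hTV)
    _ ≤ _ := by
        gcongr
        exact lintegral_enorm_gradient_comp_le hT hTM hlip hanti hsT
          hu.memLp_gradient.1.aemeasurable

theorem IsLocalParametrization.isPoincareSet (h : IsLocalParametrization M V U ψ) {K K' : ℝ≥0}
    {s T : Set (EuclideanSpace ℝ (Fin (N - 1)))} (hTV : T ⊆ V) (hT : IsOpen T)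
    (hlip : LipschitzOnWith K ψ T) (hanti : AntilipschitzWith K' (T.domRestrict ψ))
    (hs : Convex ℝ s) (hsm : MeasurableSet s) (hsb : Bornology.IsBounded s) {δ : ℝ} (hδ : 0 < δ)
    (hsT : Metric.cthickening δ s ⊆ T) {O : Set (EuclideanSpace ℝ (Fin N))} (hO : MeasurableSet O)
    (hsO : ψ '' s = M ∩ O) : IsPoincareSet M O := by
  have hvol : volume s ≠ ⊤ := hsb.measure_lt_top.ne
  have hdiam : Metric.ediam s ≠ ⊤ := hsb.ediam_ne_top
  rw [IsPoincareSet, ← Measure.restrict_apply_univ O, surfaceMeasure_restrict hO, ← hsO,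
    Measure.restrict_apply_univ]
  refine ⟨?_, ((K : ℝ≥0∞) ^ (N - 1)) ^ 2 * (2 ^ (N - 1) * volume s *
    (Metric.ediam s * (K * (K' : ℝ≥0∞) ^ (N - 1)))), by finiteness, fun u g hu => ?_⟩
  · have hmass := euclideanHausdorffMeasure_image_le
      (hlip.mono ((Metric.self_subset_cthickening s).trans hsT)) (N - 1)
    rw [EuclideanSpace.euclideanHausdorffMeasure_eq_volume] at hmass
    exact ne_top_of_le_ne_top (by finiteness) hmass
  · simpa only [mul_assoc] using
      h.totalOscillation_le hTV hT hlip hanti hs hsm hsb hδ hsT hu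

theorem IsSmoothHypersurface.exists_isPoincareSet (hM : IsSmoothHypersurface M)
    {p : EuclideanSpace ℝ (Fin N)} (hp : p ∈ M) :
    ∃ O, IsOpen O ∧ p ∈ O ∧ IsPoincareSet M O := by
  obtain ⟨V, U, ψ, h, hpU⟩ := hM p hp
  obtain ⟨y₀, hy₀, rfl⟩ : p ∈ ψ '' V := h.image_eq ▸ ⟨hp, hpU⟩
  obtain ⟨T, hTV, hTo, hyT, K, K', hlip, hanti⟩ := h.exists_lipschitzOnWith_antilipschitzWith hy₀
  obtain ⟨ε, hε, hεT⟩ := Metric.nhds_basis_closedBall.mem_iff.1 (hTo.mem_nhds hyT)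
  have hcth : Metric.cthickening (ε / 2) (Metric.ball y₀ (ε / 2)) ⊆ T := by
    rwa [cthickening_ball (half_pos hε).le (half_pos hε), add_halves]
  have hball : Metric.ball y₀ (ε / 2) ⊆ V :=
    (Metric.self_subset_cthickening _).trans (hcth.trans hTV)
  obtain ⟨O, hO, hOe⟩ := h.exists_isOpen_image_eq Metric.isOpen_ball hball
  have hpO : ψ y₀ ∈ M ∩ O := hOe ▸ mem_image_of_mem ψ (Metric.mem_ball_self (half_pos hε))
  exact ⟨O, hO, hpO.2, h.isPoincareSet hTV hTo hlip hanti (convex_ball _ _) measurableSet_ball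
    Metric.isBounded_ball (half_pos hε) hcth hO.measurableSet hOe⟩

end PoincareSets

section CompactConnected

open scoped Topology

theorem exists_isOpen_superset_of_local_of_union {X : Type*} [TopologicalSpace X] {s : Set X}
    (hcompact : IsCompact s) (hconn : IsConnected s) {P : Set X → Prop}
    (hlocal : ∀ x ∈ s, ∃ O, IsOpen O ∧ x ∈ O ∧ P O)
    (hunion : ∀ O O', IsOpen O → IsOpen O' → P O → P O' → (s ∩ (O ∩ O')).Nonempty → P (O ∪ O')) :
    ∃ O, IsOpen O ∧ s ⊆ O ∧ P O := by
  obtain ⟨p, hp⟩ := hconn.nonempty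
  have hjoin (x : X) (hx : x ∈ s) : ∃ O, IsOpen O ∧ p ∈ O ∧ x ∈ O ∧ P O := by
    refine hconn.isPreconnected.induction₂ (fun x y => ∃ O, IsOpen O ∧ x ∈ O ∧ y ∈ O ∧ P O)
      (fun x hx => ?_) ?_ ?_ hp hx
    · obtain ⟨O, hO, hxO, hP⟩ := hlocal x hx
      filter_upwards [mem_nhdsWithin_of_mem_nhds (hO.mem_nhds hxO)] with y hy
      exact ⟨O, hO, hxO, hy, hP⟩
    · rintro x y z - hy - ⟨O, hO, hxO, hyO, hP⟩ ⟨O', hO', hyO', hzO', hP'⟩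
      exact ⟨O ∪ O', hO.union hO', .inl hxO, .inr hzO',
        hunion O O' hO hO' hP hP' ⟨y, hy, hyO, hyO'⟩⟩
    · rintro x y - - ⟨O, hO, hxO, hyO, hP⟩
      exact ⟨O, hO, hyO, hxO, hP⟩
  obtain ⟨O, hO, -, hsO, hP⟩ : ∃ O, IsOpen O ∧ p ∈ O ∧ s ⊆ O ∧ P O := by
    refine hcompact.induction_on (p := fun t => ∃ O, IsOpen O ∧ p ∈ O ∧ t ⊆ O ∧ P O) ?_ ?_ ?_ ?_
    · obtain ⟨O, hO, hpO, hP⟩ := hlocal p hp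
      exact ⟨O, hO, hpO, empty_subset _, hP⟩
    · rintro t t' htt' ⟨O, hO, hpO, ht'O, hP⟩
      exact ⟨O, hO, hpO, htt'.trans ht'O, hP⟩
    · rintro t t' ⟨O, hO, hpO, htO, hP⟩ ⟨O', hO', hpO', ht'O', hP'⟩
      exact ⟨O ∪ O', hO.union hO', .inl hpO, union_subset_union htO ht'O',
        hunion O O' hO hO' hP hP' ⟨p, hp, hpO, hpO'⟩⟩
    · intro x hx
      obtain ⟨O, hO, hpO, hxO, hP⟩ := hjoin x hx
      exact ⟨O, mem_nhdsWithin_of_mem_nhds (hO.mem_nhds hxO), O, hO, hpO, Subset.rfl, hP⟩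
  exact ⟨O, hO, hsO, hP⟩

end CompactConnected

theorem IsSmoothHypersurface.isPoincareSet_univ {N : ℕ} {M : Set (EuclideanSpace ℝ (Fin N))}
    (hM : IsSmoothHypersurface M) (hcompact : IsCompact M) (hconn : IsConnected M) :
    IsPoincareSet M univ := by
  obtain ⟨O, hO, hMO, hP⟩ := exists_isOpen_superset_of_local_of_union hcompact hconn
    (fun p hp => hM.exists_isPoincareSet hp) fun O O' hO hO' hP hP' hne =>
      hP.union hP' (hM.surfaceMeasure_ne_zero (hO.inter hO') hne)
  have hrestrict : (surfaceMeasure M).restrict O = (surfaceMeasure M).restrict univ := by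
    rw [surfaceMeasure_restrict hO.measurableSet, surfaceMeasure_restrict .univ,
      inter_eq_left.2 hMO, inter_univ]
  rwa [IsPoincareSet, ← hrestrict, ← Measure.restrict_apply_univ, ← hrestrict,
    Measure.restrict_apply_univ]

theorem lemma7p1_general (N : ℕ) (M : Set (EuclideanSpace ℝ (Fin N)))
    (hM : IsSmoothHypersurface M) (hcompact : IsCompact M) (hconn : IsConnected M) :
    ∃ C : ℝ, 0 < C ∧
      ∀ (u : EuclideanSpace ℝ (Fin N) → ℝ)
        (g : EuclideanSpace ℝ (Fin N) → EuclideanSpace ℝ (Fin N)),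
        MemW11 M u g →
          eLpNorm (fun x => u x - ((surfaceMeasure M).real M)⁻¹ * ∫ y, u y ∂(surfaceMeasure M)) 1
              (surfaceMeasure M) ≤
            ENNReal.ofReal C * eLpNorm g 1 (surfaceMeasure M) := by
  obtain ⟨hfin, C, hC, hosc⟩ := hM.isPoincareSet_univ hcompact hconn
  have : IsFiniteMeasure (surfaceMeasure M) := ⟨hfin.lt_top⟩
  have hpos : surfaceMeasure M univ ≠ 0 := hM.surfaceMeasure_ne_zero isOpen_univ (by
    simpa using hconn.nonempty)
  set D := (surfaceMeasure M univ)⁻¹ * C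
  have hD : D ≠ ⊤ := by finiteness
  have hmass : (surfaceMeasure M).real M = (surfaceMeasure M).real univ := by
    simp [surfaceMeasure, Measure.real]
  refine ⟨D.toReal + 1, by positivity, fun u g hu => ?_⟩
  simp only [eLpNorm_one_eq_lintegral_enorm, hmass, ← smul_eq_mul, ← average_eq]
  calc ∫⁻ x, ‖u x - ⨍ y, u y ∂surfaceMeasure M‖ₑ ∂surfaceMeasure M
      ≤ (surfaceMeasure M univ)⁻¹ * totalOscillation (surfaceMeasure M) u :=
        lintegral_enorm_sub_average_le (memLp_one_iff_integrable.1 hu.memLp)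
    _ ≤ (surfaceMeasure M univ)⁻¹ * (C * ∫⁻ x, ‖g x‖ₑ ∂surfaceMeasure M) := by
        gcongr
        simpa only [Measure.restrict_univ] using hosc u g hu
    _ = D * ∫⁻ x, ‖g x‖ₑ ∂surfaceMeasure M := (mul_assoc _ _ _).symm
    _ ≤ ENNReal.ofReal (D.toReal + 1) * ∫⁻ x, ‖g x‖ₑ ∂surfaceMeasure M := by
        gcongr
        exact (ENNReal.le_ofReal_iff_toReal_le hD (by positivity)).2 (by linarith)

theorem lemma7p1 (N : ℕ) (hN : 3 ≤ N) (M : Set (EuclideanSpace ℝ (Fin N)))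
    (hM : IsSmoothHypersurface M) (hcompact : IsCompact M) (hconn : IsConnected M) :
    ∃ C : ℝ, 0 < C ∧
      ∀ (u : EuclideanSpace ℝ (Fin N) → ℝ)
        (g : EuclideanSpace ℝ (Fin N) → EuclideanSpace ℝ (Fin N)),
        MemW11 M u g →
          eLpNorm (fun x => u x - ((surfaceMeasure M).real M)⁻¹ * ∫ y, u y ∂(surfaceMeasure M)) 1
              (surfaceMeasure M) ≤
            ENNReal.ofReal C * eLpNorm g 1 (surfaceMeasure M) :=
  lemma7p1_general N M hM hcompact hconn
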